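/- \textbf{Proposition (Exponential decay).} Let $S$ be a connected oriented surface of genus $g$ with $p$ punctures, and let $\xi=3g-3+p$. Let $(\tau,\mu)$ be a fully measured train track on $S$, that is: $\tau$ is a train track on $S$ (every switch has branch ends on both sides and valence at least $3$, except for one bivalent switch on a simple closed curve component; every component $R$ of $S\setminus\tau$ satisfies $2\chi(R)-\#\{\text{cusps of }R\}<0$), and $\mu$ assigns to every branch a positive integer so that the switch conditions hold. Put $\|\mu\|=\sum_{b}\log_2(\mu(b)+1)$, the sum being over the branches of $\tau$. Let $s$ be a switch of $\tau$ with a co-orientation $\omega$, which orders the ends at $s$ in each of its two directions. \emph{Moves.} Suppose that $s$ has not disappeared. Choose a direction $\eta$ of $s$ such that the $\omega$-first end $e_1$ in the direction $\eta$ has weight at most $\mu(\bar b)$, where $\bar b$ is the branch of which the $\omega$-first end in the opposite direction is an end; assume that these two $\omega$-first ends are not the two ends of the same branch. Let $e_1,e_2,\dots$ be the ends in the direction $\eta$ in the order $\omega$, belonging to branches $b_1,b_2,\dots$, and let $h\ge 1$ be maximal with $\mu(b_1)+\dots+\mu(b_h)\le\mu(\bar b)$. The \emph{split} move pushes $e_1,\dots,e_h$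 along $\bar b$ to the other end $\bar b_\bullet$ of $\bar b$ and replaces $\mu(\bar b)$ by $\mu(\bar b)-\mu(b_1)-\dots-\mu(b_h)$, all other weights being kept; if the new weight is $0$, then $\bar b$ is removed, and if moreover $\bar b$ carried the whole weight of $s$, then $s$ disappears. If the end $e_{h+1}$ exists and equals $\bar b_\bullet$, the \emph{twist} move consists of $\lfloor\mu(\bar b)/(\mu(b_1)+\dots+\mu(b_h))\rfloor$ successive split moves. An \emph{AHT (Agol--Hass--Thurston) sequence} $(\tau_0,\mu_0)\supset\dots\supset(\tau_n,\mu_n)$ generated by $(\tau,\mu)$, $s$, $\omega$ starts with $(\tau_0,\mu_0)=(\tau,\mu)$, and $(\tau_{i+1},\mu_{i+1})$ is obtained from $(\tau_i,\mu_i)$ by a twist move at $(s,\omega)$ if possible, and by a split move at $(s,\omega)$ otherwise; it stops when $s$ disappears or when the two $\omega$-first ends at $s$ are the two ends of one branch (if $\mu$ represents a single curve, this means that $\tau_n$ is a simple closed curve), or earlier. \emph{Claim.} Either $n\le 6\xi+1$, or there is an integer $1\le k\le 6\xi+1$ (with $k\le n$) such that $\|\mu_k\|\le\|\mu_0\|-1$.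 Consequently \[ i<(6\xi+1)\,(\|\mu_0\|-\|\mu_i\|+1)\qquad\text{for every }0\le i\le n, \] and in particular $n<(6\xi+1)(\|\mu_0\|+1)$, so the length of an AHT sequence is linear in the bit-size of the measure. -/

import Mathlib

/-!
Train tracks on an oriented surface are represented, up to orientation-preserving homeomorphism of
the surface, by their ribbon graph together with the topological types of the complementary regions
and the way in which the boundary circles of these regions are distributed among them.
-/

/-- An end of a branch: each branch `b` has the two ends `(b, true)` and `(b, false)`. -/
abbrev BranchEnd (Br : Type*) := Br × Bool

/-- The other end of the same branch. -/
def BranchEnd.flip {Br : Type*} (e : BranchEnd Br) : BranchEnd Br := (e.1, !e.2)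

/-- Combinatorial data of a (pre-)track, with switches and branches named by elements of `Sw` and
`Br`. Each switch `s` has two directions, `true` and `false`; `ends s d` lists the ends incident to
`s` in the direction `d`, from left to right as they are seen by a traveller who leaves `s` in the
direction `d`. The axioms are in `Track.IsPreTrack`. -/
structure Track (Sw Br : Type*) where
  switches : Finset Sw
  branches : Finset Br
  ends : Sw → Bool → List (BranchEnd Br)

namespace Track

variable {Sw Br : Type*}

/-- The ends of the branches of the track. -/
def endSet (τ : Track Sw Br) : Set (BranchEnd Br) := {e | e.1 ∈ τ.branches}

/-- All properties of a train track except those about complementary regions. Every switch has ends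
in both directions, and it is at least trivalent unless it is the marking point of a simple
closed curve component (one switch, one branch). -/
structure IsPreTrack (τ : Track Sw Br) : Prop where
  ends_ne_nil : ∀ s ∈ τ.switches, ∀ d, τ.ends s d ≠ []
  ends_eq_nil : ∀ s, s ∉ τ.switches → ∀ d, τ.ends s d = []
  mem_branches : ∀ s d, ∀ e ∈ τ.ends s d, e ∈ τ.endSet
  nodup : ∀ s d, (τ.ends s d).Nodup
  existsUnique_incident : ∀ e ∈ τ.endSet, ∃! v : Sw × Bool, e ∈ τ.ends v.1 v.2
  valence : ∀ s ∈ τ.switches,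
    3 ≤ (τ.ends s true).length + (τ.ends s false).length ∨
      ∃ e : BranchEnd Br, τ.ends s true = [e] ∧ τ.ends s false = [e.flip]

/-! ### Complementary regions -/

/-- The ends incident to a switch, in clockwise order around it. -/
def cyclicEnds (τ : Track Sw Br) (s : Sw) : List (BranchEnd Br) := τ.ends s true ++ τ.ends s false

/-- An end `e` is also used as the name of the left side of its branch, when the branch is traversed
starting from `e`. After that side, the boundary of the complementary region on the left goes on
along the left side of the branch which comes, clockwise, right after the end of arrival. -/
def SideStep [DecidableEq Br] (τ : Track Sw Br) (e e' : BranchEnd Br) : Prop :=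
  ∃ s, ∃ h : e.flip ∈ τ.cyclicEnds s, (τ.cyclicEnds s).next e.flip h = e'

/-- The boundary circle of the complement (as a set of sides of branches) that contains `e`. -/
def boundaryCircle [DecidableEq Br] (τ : Track Sw Br) (e : BranchEnd Br) : Set (BranchEnd Br) :=
  {e' | Relation.ReflTransGen τ.SideStep e e'}

/-- The corner between the side `e` and the next side of the same boundary circle is a cusp: the
two ends that meet there have the same direction. -/
def CuspAfter (τ : Track Sw Br) (e : BranchEnd Br) : Prop :=
  ∃ s d, e.flip ∈ (τ.ends s d).dropLast

/-- A description of the complementary regions of a track on a surface: their number, the region on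
which each side of a branch lies, and the genus and number of punctures of each region. Each
region has at least one boundary circle, and each circle bounds one region. -/
structure Complement [DecidableEq Br] (τ : Track Sw Br) where
  count : ℕ
  region : BranchEnd Br → Fin count
  genus : Fin count → ℕ
  punctures : Fin count → ℕ
  exists_side : ∀ R, ∃ e ∈ τ.endSet, region e = R
  region_eq : ∀ e ∈ τ.endSet, ∀ e', τ.SideStep e e' → region e = region e'

namespace Complement

variable [DecidableEq Br] {τ : Track Sw Br}

/-- The number of boundary circles of the region `R`. -/
noncomputable def circleCount (C : τ.Complement) (R : Fin C.count) : ℕ :=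
  Set.ncard {F | ∃ e ∈ τ.endSet, C.region e = R ∧ F = τ.boundaryCircle e}

/-- The number of cusps of the region `R`. -/
noncomputable def cuspCount (C : τ.Complement) (R : Fin C.count) : ℕ :=
  Set.ncard {e | e ∈ τ.endSet ∧ C.region e = R ∧ τ.CuspAfter e}

/-- The Euler characteristic of the region `R`. -/
noncomputable def eulerChar (C : τ.Complement) (R : Fin C.count) : ℤ :=
  2 - 2 * (C.genus R : ℤ) - (C.circleCount R : ℤ) - (C.punctures R : ℤ)

/-- Two ends belong to the same branch, or are incident to the same switch, or are sides of the same
complementary region. -/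
def Linked (C : τ.Complement) (e e' : BranchEnd Br) : Prop :=
  e ∈ τ.endSet ∧ e' ∈ τ.endSet ∧
    (e.1 = e'.1 ∨ (∃ s d d', e ∈ τ.ends s d ∧ e' ∈ τ.ends s d') ∨ C.region e = C.region e')

/-- The surface obtained by gluing the regions to the track is connected, of genus `g`, and has `p`
punctures. -/
structure IsSurface (C : τ.Complement) (g p : ℕ) : Prop where
  connected : ∀ e ∈ τ.endSet, ∀ e' ∈ τ.endSet, Relation.EqvGen C.Linked e e'
  punctures_eq : ∑ R, C.punctures R = p
  eulerChar_eq : (2 : ℤ) - 2 * g - p =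
    (τ.switches.card : ℤ) - (τ.branches.card : ℤ) + ∑ R, C.eulerChar R

end Complement

/-- `τ` is a train track on the connected oriented surface of genus `g` with `p` punctures: each
complementary region `R` satisfies `χ(R) - (number of cusps of R) / 2 < 0`, which rules out
precisely smooth discs, monogons, bigons, smooth once-punctured discs, and smooth annuli. -/
def IsTrainTrackOn [DecidableEq Br] (g p : ℕ) (τ : Track Sw Br) : Prop :=
  τ.IsPreTrack ∧ ∃ C : τ.Complement, C.IsSurface g p ∧
    ∀ R, 2 * C.eulerChar R - (C.cuspCount R : ℤ) < 0

/-- The ends at `s` in the direction `d`, in the order given by the co-orientation `ω` of `s`. A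
co-orientation is encoded by the direction for which it orders the ends from left to right (as
seen when leaving `s`); it then orders the ends in the opposite direction from right to left. -/
def orderedEnds (τ : Track Sw Br) (s : Sw) (ω d : Bool) : List (BranchEnd Br) :=
  if d = ω then τ.ends s d else (τ.ends s d).reverse

end Track

/-- The complexity `ξ = 3g - 3 + p` of the surface of genus `g` with `p` punctures. -/
def surfaceComplexity (g p : ℕ) : ℤ := 3 * (g : ℤ) - 3 + (p : ℤ)

/-- A track together with integer weights on its branches. -/
structure MeasuredTrack (Sw Br : Type*) where
  track : Track Sw Br
  weight : Br → ℕ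

namespace MeasuredTrack

variable {Sw Br : Type*}

/-- The sum of the weights of the branches of which the ends in a list are ends. -/
def listWeight (M : MeasuredTrack Sw Br) (l : List (BranchEnd Br)) : ℕ :=
  (l.map fun e => M.weight e.1).sum

/-- The weights form a measure (the switch conditions hold) which is positive on every branch. -/
structure FullyMeasured (M : MeasuredTrack Sw Br) : Prop where
  pos : ∀ b ∈ M.track.branches, 0 < M.weight b
  switch : ∀ s ∈ M.track.switches,
    M.listWeight (M.track.ends s true) = M.listWeight (M.track.ends s false)

/-- The bit-size `‖μ‖ = ∑_b log₂ (μ(b) + 1)` of the measure. -/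
noncomputable def bitSize (M : MeasuredTrack Sw Br) : ℝ :=
  ∑ b ∈ M.track.branches, Real.logb 2 ((M.weight b : ℝ) + 1)

/-! ### Split moves, twist moves, AHT sequences

Below, `s` is a switch with co-orientation `ω`, `η` is a direction of `s`, and `f` is the `ω`-first
end in the direction opposite to `η`, so that `f.1` is the branch along which the move pushes
some ends. Branches and switches which survive a move keep their names. -/

/-- The choices `η` and `f` are admissible for a move. The last condition excludes the case in
which the `ω`-first ends of `s` in the two directions are the two ends of one branch, so that there
is nothing to push along it. This branch is then a closed curve: it is all of `τ` when `μ`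
represents a single curve, that is, the procedure has reached a simple closed curve. -/
structure MoveSetup (M : MeasuredTrack Sw Br) (s : Sw) (ω η : Bool) (f : BranchEnd Br) : Prop where
  mem : s ∈ M.track.switches
  first : (M.track.orderedEnds s ω (!η)).head? = some f
  le : ∃ e, (M.track.orderedEnds s ω η).head? = some e ∧ M.weight e.1 ≤ M.weight f.1
  not_closed : (M.track.orderedEnds s ω η).head? ≠ some f.flip

/-- The number `h` of splitting ends. -/
def splitCount (M : MeasuredTrack Sw Br) (s : Sw) (ω η : Bool) (f : BranchEnd Br) : ℕ :=
  Nat.findGreatest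
    (fun i => M.listWeight ((M.track.orderedEnds s ω η).take i) ≤ M.weight f.1)
    (M.track.orderedEnds s ω η).length

/-- The splitting ends `e₁, …, e_h`. -/
def splittingEnds (M : MeasuredTrack Sw Br) (s : Sw) (ω η : Bool) (f : BranchEnd Br) :
    List (BranchEnd Br) :=
  (M.track.orderedEnds s ω η).take (M.splitCount s ω η f)

variable [DecidableEq Sw] [DecidableEq Br]

/-- The split move: the splitting ends leave `s` and are pushed along the branch `f.1` to its other
end `f.flip`, next to which they are inserted, on the side and in the order in which they travel.
The weight of `f.1` decreases by the total weight of the splitting ends; the branch is removed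
if this gives `0`, and then `s` is removed as well if `f.1` was the only branch on its side,
i.e. if it carried the whole weight of `s`. -/
def split (s : Sw) (ω η : Bool) (f : BranchEnd Br) (M : MeasuredTrack Sw Br) :
    MeasuredTrack Sw Br :=
  let S := M.splittingEnds s ω η f
  let vanish : Prop := M.weight f.1 = M.listWeight S
  let kept : List (BranchEnd Br) := if vanish then [] else [f.flip]
  { track :=
      { switches :=
          if vanish ∧ M.weight f.1 = M.listWeight (M.track.ends s η) then M.track.switches.erase s
          else M.track.switches
        branches := if vanish then M.track.branches.erase f.1 else M.track.branches
        ends := fun z d => (M.track.ends z d).flatMap fun e =>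
          if e ∈ S then []
          else if e = f.flip then (if η = ω then S ++ kept else kept ++ S.reverse)
          else if e = f ∧ vanish then []
          else [e] }
    weight := Function.update M.weight f.1 (M.weight f.1 - M.listWeight S) }

/-- A twist move can be applied: the end right after the splitting ends is the other end of the
branch along which they are pushed. -/
def CanTwist (M : MeasuredTrack Sw Br) (s : Sw) (ω η : Bool) (f : BranchEnd Br) : Prop :=
  (M.track.orderedEnds s ω η)[M.splitCount s ω η f]? = some f.flip

/-- The twist move: `k = ⌊μ(f.1) / (μ(b₁) + ⋯ + μ(b_h))⌋` successive split moves. -/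
def twist (s : Sw) (ω η : Bool) (f : BranchEnd Br) (M : MeasuredTrack Sw Br) :
    MeasuredTrack Sw Br :=
  (split s ω η f)^[M.weight f.1 / M.listWeight (M.splittingEnds s ω η f)] M

/-- One step of the Agol-Hass-Thurston procedure at the co-oriented switch `(s, ω)`: a twist move if
possible, and a split move otherwise. There is no step once `s` has disappeared. If the `ω`-first
ends in the two directions have the same weight, `η` may be chosen either way. -/
inductive AHTStep (s : Sw) (ω : Bool) : MeasuredTrack Sw Br → MeasuredTrack Sw Br → Prop
  | twist (M : MeasuredTrack Sw Br) (η : Bool) (f : BranchEnd Br) :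
      M.MoveSetup s ω η f → M.CanTwist s ω η f → AHTStep s ω M (twist s ω η f M)
  | split (M : MeasuredTrack Sw Br) (η : Bool) (f : BranchEnd Br) :
      M.MoveSetup s ω η f → ¬ M.CanTwist s ω η f → AHTStep s ω M (split s ω η f M)

/-- `T 0, …, T n` is an AHT sequence (possibly stopped prematurely) on the surface of genus `g` with
`p` punctures, generated by `T 0`, the switch `s` and the co-orientation `ω`. -/
structure IsAHTSequence (g p : ℕ) (s : Sw) (ω : Bool) (n : ℕ) (T : ℕ → MeasuredTrack Sw Br) :
    Prop where
  trainTrack : (T 0).track.IsTrainTrackOn g p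
  fullyMeasured : (T 0).FullyMeasured
  mem : s ∈ (T 0).track.switches
  step : ∀ i < n, AHTStep s ω (T i) (T (i + 1))

end MeasuredTrack

/-! The proof has two independent halves, a bound on the number of branches and a pigeonhole
argument on the moves.

Branches: let `S`, `B`, `K` be the numbers of switches, branches and cusps, and `c` the number of
bivalent switches. Counting ends at switches gives `K ≤ 2B - 2S` and `3S ≤ 2B + c`. The negativity
condition yields a linear inequality for every region (`Complement.region_inequality`). Summed and
combined with the Euler characteristic of the surface, it gives `B ≤ 6ξ`.

Moves: every step lowers the weight of one branch, from `x` to `y` say. If `2(y+1) ≤ x+1`, the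
bit-size drops by `1` at once; this covers twists and removals of a branch. Otherwise the lowered
branch is first on its side and lighter than the first branch on the other side, so the next step
pushes it, and that step satisfies `y' + y ≤ x'` (`AHTStep.exists_lowers`).

Suppose that no single step halves. Among one more steps than there are branches, two steps `i <
m+1` lower the same branch. The inequalities `y ≤ x'` make the losses telescope between them. Let
`t` be the weight that step `m+1` lowers. Then `y_m + y_{m+1} ≤ t ≤ y_i`, so `(y_i+1)(t+1) ≥
2(y_m+1)(y_{m+1}+1)`, and the bit-size has dropped by at least `1` after all
(`exists_bitSize_le_sub_one`). Iterating this gives the linear bound. Branches are never created, so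
the bound on the initial track serves throughout, although later tracks need not satisfy the train
track axioms. -/

namespace Track

open Finset

variable {Sw Br : Type*} {τ : Track Sw Br}

/-! ### Counting ends, cusps and switches -/

/-- The ends of the branches of a track, as a finite set. -/
def endFinset (τ : Track Sw Br) : Finset (BranchEnd Br) := τ.branches ×ˢ Finset.univ

@[simp] lemma mem_endFinset {e : BranchEnd Br} : e ∈ τ.endFinset ↔ e ∈ τ.endSet := by
  simp [endFinset, endSet]

lemma card_endFinset : τ.endFinset.card = 2 * τ.branches.card := by
  simp [endFinset, mul_comm]

lemma flip_flip (e : BranchEnd Br) : e.flip.flip = e := by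
  simp [BranchEnd.flip]

lemma flip_ne (e : BranchEnd Br) : e.flip ≠ e := by
  intro h
  have := congrArg Prod.snd h
  simp [BranchEnd.flip] at this

lemma IsPreTrack.incident_unique (h : τ.IsPreTrack) {e : BranchEnd Br} {s s' : Sw} {d d' : Bool}
    (he : e ∈ τ.ends s d) (he' : e ∈ τ.ends s' d') : s = s' ∧ d = d' := by
  obtain ⟨v, -, hv⟩ := h.existsUnique_incident e (h.mem_branches s d e he)
  have h1 := hv (s, d) he
  have h2 := hv (s', d') he'
  simpa using h1.trans h2.symm

/-- A switch which is the marking point of a simple closed curve component. -/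
def IsBivalent (τ : Track Sw Br) (s : Sw) (e : BranchEnd Br) : Prop :=
  τ.ends s true = [e] ∧ τ.ends s false = [e.flip]

lemma IsPreTrack.sum_length_le (h : τ.IsPreTrack) :
    ∑ s ∈ τ.switches, ((τ.ends s true).length + (τ.ends s false).length) ≤
      2 * τ.branches.card := by
  classical
  have hb : (τ.switches ×ˢ (univ : Finset Bool)).biUnion (fun v => (τ.ends v.1 v.2).toFinset) ⊆
      τ.endFinset := by
    intro e he
    simp only [Finset.mem_biUnion, List.mem_toFinset] at he
    obtain ⟨v, -, hv⟩ := he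
    exact mem_endFinset.2 (h.mem_branches _ _ _ hv)
  have hc := Finset.card_le_card hb
  rw [Finset.card_biUnion, card_endFinset] at hc
  · refine le_trans (le_of_eq ?_) hc
    rw [Finset.sum_product]
    refine Finset.sum_congr rfl fun s _ => ?_
    simp [List.toFinset_card_of_nodup (h.nodup _ _)]
  · intro v _ v' _ hne
    refine Finset.disjoint_left.2 fun e he he' => ?_
    have := h.incident_unique (List.mem_toFinset.1 he) (List.mem_toFinset.1 he')
    exact hne (Prod.ext this.1 this.2)

/-- Consecutive ends in one direction bound one cusp, so `k` ends give `k - 1` cusps. Each switch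
has two directions and thus loses `2` from its valence. -/
lemma IsPreTrack.card_cusps_add_le (h : τ.IsPreTrack) :
    {e | e ∈ τ.endSet ∧ τ.CuspAfter e}.ncard + 2 * τ.switches.card ≤
      2 * τ.branches.card := by
  classical
  refine le_trans ?_ h.sum_length_le
  have hsub : {e | e ∈ τ.endSet ∧ τ.CuspAfter e} ⊆
      (((τ.switches ×ˢ (univ : Finset Bool)).biUnion
        (fun v => ((τ.ends v.1 v.2).dropLast.map BranchEnd.flip).toFinset) :
        Finset (BranchEnd Br)) : Set (BranchEnd Br)) := by
    rintro e ⟨-, s, d, he⟩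
    simp only [Finset.coe_biUnion, Set.mem_iUnion, Finset.mem_coe, List.mem_toFinset]
    refine ⟨(s, d), ?_, List.mem_map.2 ⟨_, he, flip_flip e⟩⟩
    simp only [mem_product, mem_univ, and_true]
    by_contra hs
    simp [h.ends_eq_nil s hs] at he
  have hc := Set.ncard_le_ncard hsub (Finset.finite_toSet _)
  rw [Set.ncard_coe_finset] at hc
  have h2 := hc.trans Finset.card_biUnion_le
  rw [Finset.sum_product] at h2
  have h3 : ∑ s ∈ τ.switches, ((∑ d : Bool,
      ((τ.ends s d).dropLast.map BranchEnd.flip).toFinset.card) + 2) ≤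
      ∑ s ∈ τ.switches, ((τ.ends s true).length + (τ.ends s false).length) := by
    refine Finset.sum_le_sum fun s hs => ?_
    have hl : ∀ d, ((τ.ends s d).dropLast.map BranchEnd.flip).toFinset.card + 1 ≤
        (τ.ends s d).length := by
      intro d
      have h4 := List.toFinset_card_le ((τ.ends s d).dropLast.map BranchEnd.flip)
      have h5 := List.length_pos_of_ne_nil (h.ends_ne_nil s hs d)
      simp only [List.length_map, List.length_dropLast] at h4
      omega
    have := hl true
    have := hl false
    simp only [Fintype.sum_bool]
    omega
  rw [Finset.sum_add_distrib] at h3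
  simp only [sum_const, smul_eq_mul] at h2 h3
  omega

/-- A bivalent switch falls short of valence `3` by exactly one. -/
lemma IsPreTrack.three_mul_card_switches_le (h : τ.IsPreTrack) :
    3 * τ.switches.card ≤
      2 * τ.branches.card + {s | s ∈ τ.switches ∧ ∃ e, τ.IsBivalent s e}.ncard := by
  classical
  have hset : {s | s ∈ τ.switches ∧ ∃ e, τ.IsBivalent s e} =
      ((τ.switches.filter fun s => ∃ e, τ.IsBivalent s e : Finset Sw) : Set Sw) := by
    ext; simp
  rw [hset, Set.ncard_coe_finset, Finset.card_filter]
  refine le_trans ?_ (Nat.add_le_add_right h.sum_length_le _)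
  rw [← Finset.sum_add_distrib, mul_comm, ← smul_eq_mul, ← Finset.sum_const]
  refine Finset.sum_le_sum fun s hs => ?_
  split_ifs with hb
  · have := List.length_pos_of_ne_nil (h.ends_ne_nil s hs true)
    have := List.length_pos_of_ne_nil (h.ends_ne_nil s hs false)
    omega
  · rcases h.valence s hs with h3 | h3
    · omega
    · exact absurd h3 hb

lemma IsPreTrack.not_cuspAfter_of_isBivalent (h : τ.IsPreTrack) {s : Sw} {e : BranchEnd Br}
    (hb : τ.IsBivalent s e) : ¬ τ.CuspAfter e := by
  rintro ⟨s', d, hm⟩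
  have hf : e.flip ∈ τ.ends s false := by rw [hb.2]; simp
  obtain ⟨rfl, rfl⟩ := h.incident_unique (List.mem_of_mem_dropLast hm) hf
  simp [hb.2] at hm

lemma finite_endSet_sep (p : BranchEnd Br → Prop) : {e | e ∈ τ.endSet ∧ p e}.Finite :=
  (τ.endFinset.finite_toSet).subset fun _ he => mem_endFinset.2 he.1

variable [DecidableEq Br]

lemma IsPreTrack.boundaryCircle_of_isBivalent (h : τ.IsPreTrack) {s : Sw} {e : BranchEnd Br}
    (hb : τ.IsBivalent s e) : τ.boundaryCircle e = {e} := by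
  ext e'
  simp only [boundaryCircle, Set.mem_ofPred_eq, Set.mem_singleton_iff]
  refine ⟨fun hr => ?_, fun hr => hr ▸ Relation.ReflTransGen.refl⟩
  induction hr with
  | refl => rfl
  | @tail e₁ e₂ _ hstep ih =>
    obtain rfl : e₁ = e := ih
    obtain ⟨s', hm, rfl⟩ := hstep
    have hs : s' = s := by
      have hf : e₁.flip ∈ τ.ends s false := by rw [hb.2]; simp
      rcases List.mem_append.1 hm with h1 | h1
      · exact (h.incident_unique h1 hf).1
      · exact (h.incident_unique h1 hf).1
    subst hs
    have hl : τ.cyclicEnds s' = [e₁, e₁.flip] := by simp [cyclicEnds, hb.1, hb.2]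
    have key : ∀ (l : List (BranchEnd Br)) (hl : l = [e₁, e₁.flip]) (hm : e₁.flip ∈ l),
        l.next e₁.flip hm = e₁ := by
      rintro _ rfl hm
      simp [List.next, List.nextOr]
    exact key _ hl _

/-! ### Complementary regions and the bound on the number of branches -/

namespace Complement

variable (C : τ.Complement)

/-- The number of simple closed curve components whose chosen side lies on the region `R`. -/
noncomputable def curveCount (R : Fin C.count) : ℕ :=
  Set.ncard {e | e ∈ τ.endSet ∧ C.region e = R ∧ ∃ s, τ.IsBivalent s e}

lemma finite_circles (R : Fin C.count) :
    {F | ∃ e ∈ τ.endSet, C.region e = R ∧ F = τ.boundaryCircle e}.Finite := by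
  refine ((finite_endSet_sep (τ := τ) fun _ => True).image τ.boundaryCircle).subset ?_
  rintro F ⟨e, he, -, rfl⟩
  exact ⟨e, ⟨he, trivial⟩, rfl⟩

lemma one_le_circleCount (R : Fin C.count) : 1 ≤ C.circleCount R := by
  obtain ⟨e, he, hR⟩ := C.exists_side R
  exact (Set.ncard_pos (C.finite_circles R)).2 ⟨_, e, he, hR, rfl⟩

lemma image_curves_eq (R : Fin C.count) :
    Set.ncard ((fun e : BranchEnd Br => ({e} : Set (BranchEnd Br))) ''
      {e | e ∈ τ.endSet ∧ C.region e = R ∧ ∃ s, τ.IsBivalent s e}) = C.curveCount R :=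
  Set.ncard_image_of_injective _ Set.singleton_injective

lemma image_curves_subset (h : τ.IsPreTrack) (R : Fin C.count) :
    ((fun e : BranchEnd Br => ({e} : Set (BranchEnd Br))) ''
      {e | e ∈ τ.endSet ∧ C.region e = R ∧ ∃ s, τ.IsBivalent s e}) ⊆
      {F | ∃ e ∈ τ.endSet, C.region e = R ∧ F = τ.boundaryCircle e} := by
  rintro _ ⟨e, ⟨he, hR, s, hb⟩, rfl⟩
  exact ⟨e, he, hR, (h.boundaryCircle_of_isBivalent hb).symm⟩

lemma curveCount_le (h : τ.IsPreTrack) (R : Fin C.count) :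
    C.curveCount R ≤ C.circleCount R := by
  rw [← C.image_curves_eq]
  exact Set.ncard_le_ncard (C.image_curves_subset h R) (C.finite_circles R)

/-- A simple closed curve component contributes a smooth one-sided circle, so the circle through a
cusp is not among those counted by `curveCount`. -/
lemma curveCount_lt (h : τ.IsPreTrack) (R : Fin C.count) (hc : C.cuspCount R ≠ 0) :
    C.curveCount R < C.circleCount R := by
  rw [← C.image_curves_eq]
  refine Set.ncard_lt_ncard ((Set.ssubset_iff_of_subset (C.image_curves_subset h R)).2 ?_)
    (C.finite_circles R)
  obtain ⟨e, he, hR, hcusp⟩ := Set.nonempty_of_ncard_ne_zero hc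
  refine ⟨_, ⟨e, he, hR, rfl⟩, ?_⟩
  rintro ⟨e', ⟨-, -, s, hb⟩, heq⟩
  have hmem : e ∈ τ.boundaryCircle e := Relation.ReflTransGen.refl
  rw [← heq, Set.mem_singleton_iff] at hmem
  subst hmem
  exact h.not_cuspAfter_of_isBivalent hb hcusp

/-- The coefficients are those needed for the final count; equality holds for a triangle and for a
once-punctured monogon. The term `curveCount` pays for the bivalent switches. -/
lemma region_inequality (h : τ.IsPreTrack) (R : Fin C.count)
    (hR : 2 * C.eulerChar R - (C.cuspCount R : ℤ) < 0) :
    9 * C.eulerChar R + 3 * (C.punctures R : ℤ) + (C.curveCount R : ℤ) ≤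
      3 * (C.cuspCount R : ℤ) := by
  have h1 := C.one_le_circleCount R
  have h2 := C.curveCount_le h R
  have h3 := C.curveCount_lt h R
  unfold eulerChar at *
  by_cases h0 : C.cuspCount R = 0
  · omega
  · have := h3 h0
    omega

lemma sum_ncard_region (p : BranchEnd Br → Prop) :
    ∑ R, Set.ncard {e | e ∈ τ.endSet ∧ C.region e = R ∧ p e} =
      Set.ncard {e | e ∈ τ.endSet ∧ p e} := by
  classical
  have hset : ∀ q : BranchEnd Br → Prop, Set.ncard {e | e ∈ τ.endSet ∧ q e} =
      (τ.endFinset.filter q).card := by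
    intro q
    rw [← Set.ncard_coe_finset]
    congr 1
    ext; simp
  simp_rw [hset]
  rw [Finset.card_eq_sum_card_fiberwise (f := C.region) (t := Finset.univ) (by simp)]
  refine Finset.sum_congr rfl fun R _ => ?_
  rw [Finset.filter_filter]
  simp_rw [and_comm]

lemma ncard_bivalent_le (h : τ.IsPreTrack) :
    {s | s ∈ τ.switches ∧ ∃ e, τ.IsBivalent s e}.ncard ≤ ∑ R, C.curveCount R := by
  classical
  rcases isEmpty_or_nonempty (BranchEnd Br) with hE | hE
  -- Without any end there is no default value for the choice function below.
  · simp [Set.ofPred_false]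
  unfold curveCount
  rw [C.sum_ncard_region]
  choose! f hf using fun (s : Sw) (hs : ∃ e, τ.IsBivalent s e) => hs
  refine Set.ncard_le_ncard_of_injOn f ?_ ?_ (finite_endSet_sep _)
  · rintro s ⟨-, hs⟩
    have hb := hf s hs
    exact ⟨h.mem_branches s true _ (by rw [hb.1]; simp), s, hb⟩
  · rintro s ⟨-, hs⟩ s' ⟨-, hs'⟩ heq
    have hb := hf s hs
    have hb' := hf s' hs'
    refine (h.incident_unique (e := f s) (d := true) (d' := true) ?_ ?_).1
    · rw [hb.1]; simp
    · rw [hb'.1, heq]; simp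

end Complement

/-- A train track on a surface has at most `6ξ` branches. -/
theorem IsTrainTrackOn.card_branches_le {g p : ℕ} (h : IsTrainTrackOn g p τ) :
    (τ.branches.card : ℤ) ≤ 6 * surfaceComplexity g p := by
  obtain ⟨hp, C, hS, hneg⟩ := h
  have hsum := Finset.sum_le_sum fun R (_ : R ∈ Finset.univ) => C.region_inequality hp R (hneg R)
  simp only [Finset.sum_add_distrib, ← Finset.mul_sum] at hsum
  have hcusp : ∑ R, C.cuspCount R = _ := C.sum_ncard_region τ.CuspAfter
  have h1 := hp.card_cusps_add_le
  have h2 := hp.three_mul_card_switches_le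
  have h3 := C.ncard_bivalent_le hp
  have h4 := hS.eulerChar_eq
  have h5 := hS.punctures_eq
  rw [← hcusp] at h1
  unfold surfaceComplexity
  zify at h1 h2 h3 h5
  -- The region sum enters once, the cusp count three times, the Euler characteristic nine times,
  -- and each count of bivalent switches once.
  linarith

end Track

/-! ### Weights near the switch and the invariant of the procedure -/

lemma BranchEnd.eq_or_eq_flip {Br : Type*} {e f : BranchEnd Br} (h : e.1 = f.1) :
    e = f ∨ e = f.flip := by
  obtain ⟨b, x⟩ := e
  obtain ⟨c, y⟩ := f
  obtain rfl : b = c := h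
  cases x <;> cases y <;> simp [BranchEnd.flip]

namespace MeasuredTrack

open Finset

variable {Sw Br : Type*}

lemma listWeight_append (M : MeasuredTrack Sw Br) (l l' : List (BranchEnd Br)) :
    M.listWeight (l ++ l') = M.listWeight l + M.listWeight l' := by
  simp [listWeight]

lemma listWeight_cons (M : MeasuredTrack Sw Br) (e : BranchEnd Br) (l : List (BranchEnd Br)) :
    M.listWeight (e :: l) = M.weight e.1 + M.listWeight l := by
  simp [listWeight]

@[simp] lemma listWeight_nil (M : MeasuredTrack Sw Br) : M.listWeight [] = 0 := rfl

lemma listWeight_reverse (M : MeasuredTrack Sw Br) (l : List (BranchEnd Br)) :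
    M.listWeight l.reverse = M.listWeight l := by
  simp [listWeight]

lemma weight_le_listWeight (M : MeasuredTrack Sw Br) {e : BranchEnd Br}
    {l : List (BranchEnd Br)} (h : e ∈ l) : M.weight e.1 ≤ M.listWeight l :=
  List.single_le_sum (by simp) _ (List.mem_map.2 ⟨e, h, rfl⟩)

lemma listWeight_orderedEnds (M : MeasuredTrack Sw Br) (s : Sw) (ω d : Bool) :
    M.listWeight (M.track.orderedEnds s ω d) = M.listWeight (M.track.ends s d) := by
  unfold Track.orderedEnds
  split_ifs
  · rfl
  · exact M.listWeight_reverse _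

lemma mem_orderedEnds {τ : Track Sw Br} {s : Sw} {ω d : Bool} {e : BranchEnd Br} :
    e ∈ τ.orderedEnds s ω d ↔ e ∈ τ.ends s d := by
  unfold Track.orderedEnds
  split_ifs <;> simp

lemma orderedEnds_perm (τ : Track Sw Br) (s : Sw) (ω d : Bool) :
    (τ.orderedEnds s ω d).Perm (τ.ends s d) := by
  unfold Track.orderedEnds
  split_ifs
  · rfl
  · exact List.reverse_perm _

lemma listWeight_perm (M : MeasuredTrack Sw Br) {l l' : List (BranchEnd Br)} (h : l.Perm l') :
    M.listWeight l = M.listWeight l' :=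
  (h.map _).sum_eq

/-- The properties of a fully measured track near the switch `s` on which the procedure at `s`
depends. They are preserved by every move, even when a move creates a bivalent switch. -/
structure RegularAt (M : MeasuredTrack Sw Br) (s : Sw) : Prop where
  nodup : (M.track.ends s true ++ M.track.ends s false).Nodup
  mem_branches : ∀ d, ∀ e ∈ M.track.ends s d, e.1 ∈ M.track.branches
  pos : ∀ b ∈ M.track.branches, 0 < M.weight b
  switch : ∀ d, M.listWeight (M.track.ends s d) = M.listWeight (M.track.ends s (!d))

lemma FullyMeasured.regularAt {M : MeasuredTrack Sw Br} (hM : M.FullyMeasured)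
    (h : M.track.IsPreTrack) {s : Sw} (hs : s ∈ M.track.switches) : M.RegularAt s where
  nodup := by
    refine List.nodup_append'.2 ⟨h.nodup s _, h.nodup s _, fun e he he' => ?_⟩
    simpa using (h.incident_unique he he').2
  mem_branches := fun d e he => h.mem_branches s d e he
  pos := hM.pos
  switch := by
    have := hM.switch s hs
    rintro (_ | _)
    · exact this.symm
    · exact this

namespace RegularAt

variable {M : MeasuredTrack Sw Br} {s : Sw}

lemma not_mem_opposite (h : M.RegularAt s) {e : BranchEnd Br} {d : Bool}
    (he : e ∈ M.track.ends s d) : e ∉ M.track.ends s (!d) := by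
  have := (List.nodup_append'.1 h.nodup).2.2
  cases d
  · exact fun he' => this he' he
  · exact fun he' => this he he'

lemma nodup_orderedEnds (h : M.RegularAt s) (ω d : Bool) :
    (M.track.orderedEnds s ω d).Nodup := by
  have h1 := List.nodup_append'.1 h.nodup
  have h2 : (M.track.ends s d).Nodup := by
    cases d
    · exact h1.2.1
    · exact h1.1
  unfold Track.orderedEnds
  split_ifs
  · exact h2
  · exact List.nodup_reverse.2 h2

lemma weight_pos (h : M.RegularAt s) {e : BranchEnd Br} {d : Bool}
    (he : e ∈ M.track.ends s d) : 0 < M.weight e.1 :=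
  h.pos _ (h.mem_branches d e he)

lemma switch_orderedEnds (h : M.RegularAt s) (ω d : Bool) :
    M.listWeight (M.track.orderedEnds s ω d) = M.listWeight (M.track.orderedEnds s ω (!d)) := by
  simpa only [listWeight_orderedEnds] using h.switch d

end RegularAt

/-! ### The maximal block of ends that is pushed -/

section splittingEnds

variable (M : MeasuredTrack Sw Br) (s : Sw) (ω η : Bool) (f : BranchEnd Br)

lemma listWeight_splittingEnds_le : M.listWeight (M.splittingEnds s ω η f) ≤ M.weight f.1 := by
  refine Nat.findGreatest_spec
    (P := fun i => M.listWeight ((M.track.orderedEnds s ω η).take i) ≤ M.weight f.1)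
    (Nat.zero_le (M.track.orderedEnds s ω η).length) ?_
  simp

lemma exists_orderedEnds_eq :
    ∃ rest, M.track.orderedEnds s ω η = M.splittingEnds s ω η f ++ rest ∧
      rest.head? = (M.track.orderedEnds s ω η)[M.splitCount s ω η f]? := by
  refine ⟨(M.track.orderedEnds s ω η).drop (M.splitCount s ω η f), ?_, ?_⟩
  · exact (List.take_append_drop _ _).symm
  · simp

variable {M s ω η f}

lemma lt_listWeight_of_orderedEnds_eq {e : BranchEnd Br} {rest : List (BranchEnd Br)}
    (h : M.track.orderedEnds s ω η = M.splittingEnds s ω η f ++ e :: rest) :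
    M.weight f.1 < M.listWeight (M.splittingEnds s ω η f) + M.weight e.1 := by
  by_contra! hle
  have hlen : (M.splittingEnds s ω η f).length = M.splitCount s ω η f := by
    refine List.length_take_of_le ?_
    exact Nat.findGreatest_le _
  have hlen2 := congrArg List.length h
  simp only [List.length_append, List.length_cons, hlen] at hlen2
  refine Nat.findGreatest_is_greatest
    (P := fun i => M.listWeight ((M.track.orderedEnds s ω η).take i) ≤ M.weight f.1)
    (n := (M.track.orderedEnds s ω η).length) (k := M.splitCount s ω η f + 1)
    (Nat.lt_succ_self _) (by omega) ?_
  have ht : (M.track.orderedEnds s ω η).take (M.splitCount s ω η f + 1) =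
      M.splittingEnds s ω η f ++ [e] := by
    rw [h, ← hlen, List.take_length_add_append]
    simp
  simpa only [ht, listWeight_append, listWeight_cons, listWeight_nil, add_zero] using hle

/-- Positivity of weights is not needed: partial sums are monotone, so overflowing at `e` rules out
every longer block. -/
lemma splittingEnds_eq_of_orderedEnds_eq {S : List (BranchEnd Br)} {e : BranchEnd Br}
    {rest : List (BranchEnd Br)} (h : M.track.orderedEnds s ω η = S ++ e :: rest)
    (hle : M.listWeight S ≤ M.weight f.1) (hlt : M.weight f.1 < M.listWeight S + M.weight e.1) :
    M.splittingEnds s ω η f = S := by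
  have hcount : M.splitCount s ω η f = S.length := by
    refine Nat.findGreatest_eq_iff.2 ⟨by simp [h], fun _ => by simpa [h] using hle, ?_⟩
    intro n hn _ hc
    rw [h] at hc
    obtain ⟨m, rfl⟩ := Nat.exists_eq_add_of_lt hn
    rw [add_assoc, List.take_length_add_append, List.take_succ_cons, listWeight_append,
      listWeight_cons] at hc
    omega
  rw [splittingEnds, hcount, h]
  simp

lemma mem_of_mem_splittingEnds {e : BranchEnd Br} (he : e ∈ M.splittingEnds s ω η f) :
    e ∈ M.track.ends s η :=
  mem_orderedEnds.1 (List.mem_of_mem_take he)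

lemma splittingEnds_eq_cons {e : BranchEnd Br}
    (he : (M.track.orderedEnds s ω η).head? = some e) (hle : M.weight e.1 ≤ M.weight f.1) :
    ∃ l, M.splittingEnds s ω η f = e :: l := by
  obtain ⟨l, hl⟩ : ∃ l, M.track.orderedEnds s ω η = e :: l := List.head?_eq_some_iff.1 he
  obtain ⟨rest, hrest, -⟩ := M.exists_orderedEnds_eq s ω η f
  cases hS : M.splittingEnds s ω η f with
  | cons a t =>
    rw [hS, hl, List.cons_append] at hrest
    exact ⟨t, by rw [(List.cons.inj hrest).1]⟩
  | nil =>
    rw [hS, hl, List.nil_append] at hrest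
    have h2 := lt_listWeight_of_orderedEnds_eq (f := f) (e := e) (rest := l)
      (by rw [hS, hl, List.nil_append])
    rw [hS, listWeight_nil] at h2
    omega

end splittingEnds

/-- Some ends at `s` can be pushed along the branch of `f`, an end at `s` in the direction opposite
to `η`. -/
structure CanPush (M : MeasuredTrack Sw Br) (s : Sw) (ω η : Bool) (f : BranchEnd Br) : Prop where
  regular : M.RegularAt s
  mem : f ∈ M.track.ends s (!η)
  ne_nil : M.splittingEnds s ω η f ≠ []
  flip_not_mem : f.flip ∉ M.splittingEnds s ω η f

namespace CanPush

variable {M : MeasuredTrack Sw Br} {s : Sw} {ω η : Bool} {f : BranchEnd Br}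

lemma not_mem (h : M.CanPush s ω η f) : f ∉ M.splittingEnds s ω η f := fun hf => by
  have := h.regular.not_mem_opposite h.mem
  rw [Bool.not_not] at this
  exact this (mem_of_mem_splittingEnds hf)

lemma branch_ne (h : M.CanPush s ω η f) {e : BranchEnd Br}
    (he : e ∈ M.splittingEnds s ω η f) : e.1 ≠ f.1 := fun heq => by
  rcases BranchEnd.eq_or_eq_flip heq with rfl | rfl
  · exact h.not_mem he
  · exact h.flip_not_mem he

lemma listWeight_pos (h : M.CanPush s ω η f) :
    0 < M.listWeight (M.splittingEnds s ω η f) := by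
  obtain ⟨e, he⟩ := List.exists_mem_of_ne_nil _ h.ne_nil
  exact lt_of_lt_of_le (h.regular.weight_pos (mem_of_mem_splittingEnds he))
    (M.weight_le_listWeight he)

end CanPush

/-! ### The effect of one split move -/

section split

variable [DecidableEq Br]

/-- What a split move leaves at the place of the end `e`. -/
def splitEnd (M : MeasuredTrack Sw Br) (s : Sw) (ω η : Bool) (f e : BranchEnd Br) :
    List (BranchEnd Br) :=
  if e ∈ M.splittingEnds s ω η f then []
  else if e = f.flip then
    (if η = ω then M.splittingEnds s ω η f ++
        (if M.weight f.1 = M.listWeight (M.splittingEnds s ω η f) then [] else [f.flip])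
      else (if M.weight f.1 = M.listWeight (M.splittingEnds s ω η f) then [] else [f.flip]) ++
        (M.splittingEnds s ω η f).reverse)
  else if e = f ∧ M.weight f.1 = M.listWeight (M.splittingEnds s ω η f) then []
  else [e]

lemma flatMap_splittingEnds  (M : MeasuredTrack Sw Br) (s : Sw) (ω η : Bool)
    (f : BranchEnd Br) : (M.splittingEnds s ω η f).flatMap (M.splitEnd s ω η f) = [] := by
  refine List.flatMap_eq_nil_iff.2 fun e he => ?_
  simp [splitEnd, he]

/-- Pushed ends reappear only at `f.flip`, all others stay in place, and no end of a vanishing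
branch survives. This yields both distinctness and membership after a split. -/
lemma CanPush.mem_splitEnd {M : MeasuredTrack Sw Br} {s : Sw} {ω η : Bool} {f : BranchEnd Br}
    (h : M.CanPush s ω η f) {z e : BranchEnd Br} (hz : z ∈ M.splitEnd s ω η f e) :
    ((z = e ∧ e ∉ M.splittingEnds s ω η f) ∨ (e = f.flip ∧ z ∈ M.splittingEnds s ω η f)) ∧
      (M.weight f.1 = M.listWeight (M.splittingEnds s ω η f) → z.1 ≠ f.1) := by
  have h1 := @CanPush.branch_ne _ _ _ _ _ _ _ h
  have h2 := h.flip_not_mem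
  unfold splitEnd at hz
  split_ifs at hz with h3 h4 h5 h6 h6 h6
  all_goals simp only [List.append_nil, List.nil_append, List.mem_append, List.mem_reverse,
    List.mem_singleton, List.not_mem_nil] at hz
  · exact ⟨Or.inr ⟨h4, hz⟩, fun _ => h1 hz⟩
  · refine ⟨?_, fun h7 => absurd h7 h6⟩
    rcases hz with hz | hz
    · exact Or.inr ⟨h4, hz⟩
    · exact Or.inl ⟨hz.trans h4.symm, h3⟩
  · exact ⟨Or.inr ⟨h4, hz⟩, fun _ => h1 hz⟩
  · refine ⟨?_, fun h7 => absurd h7 h6⟩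
    rcases hz with hz | hz
    · exact Or.inl ⟨hz.trans h4.symm, h3⟩
    · exact Or.inr ⟨h4, hz⟩
  · subst hz
    refine ⟨Or.inl ⟨rfl, h3⟩, fun h7 heq => ?_⟩
    rcases BranchEnd.eq_or_eq_flip heq with rfl | rfl
    · exact h6 ⟨rfl, h7⟩
    · exact h4 rfl

lemma CanPush.nodup_splitEnd {M : MeasuredTrack Sw Br} {s : Sw} {ω η : Bool} {f : BranchEnd Br}
    (h : M.CanPush s ω η f) (e : BranchEnd Br) : (M.splitEnd s ω η f e).Nodup := by
  have hS : (M.splittingEnds s ω η f).Nodup :=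
    (h.regular.nodup_orderedEnds ω η).sublist (List.take_sublist _ _)
  have h2 := h.flip_not_mem
  unfold splitEnd
  split_ifs
  all_goals simp [List.nodup_append', hS, h2]

lemma CanPush.nodup_flatMap {M : MeasuredTrack Sw Br} {s : Sw} {ω η : Bool} {f : BranchEnd Br}
    (h : M.CanPush s ω η f) {l : List (BranchEnd Br)} (hl : l.Nodup) :
    (l.flatMap (M.splitEnd s ω η f)).Nodup := by
  refine List.nodup_flatMap.2 ⟨fun e _ => h.nodup_splitEnd e, ?_⟩
  refine List.Pairwise.imp (fun {x y} hxy => ?_) hl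
  refine List.disjoint_left.2 fun z hx hy => ?_
  rcases (h.mem_splitEnd hx).1 with ⟨hzx, hx'⟩ | ⟨hzx, hx'⟩ <;>
    rcases (h.mem_splitEnd hy).1 with ⟨hzy, hy'⟩ | ⟨hzy, hy'⟩
  · exact hxy (hzx.symm.trans hzy)
  · exact hx' (hzx ▸ hy')
  · exact hy' (hzy ▸ hx')
  · exact hxy (hzx.trans hzy.symm)

/-- The weight of the branch `b` has been lowered to `y`, and `b` has been removed if `y = 0`. -/
structure Lowers (M M' : MeasuredTrack Sw Br) (b : Br) (y : ℕ) : Prop where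
  mem : b ∈ M.track.branches
  lt : y < M.weight b
  weight_eq : M'.weight = Function.update M.weight b y
  branches_eq : M'.track.branches = if y = 0 then M.track.branches.erase b else M.track.branches

namespace Lowers

variable {M M' M'' : MeasuredTrack Sw Br} {b : Br} {y y' : ℕ}

lemma weight_self (h : Lowers M M' b y) : M'.weight b = y := by simp [h.weight_eq]

lemma weight_le (h : Lowers M M' b y) (c : Br) : M'.weight c ≤ M.weight c := by
  rw [h.weight_eq]
  rcases eq_or_ne c b with rfl | hc
  · simpa using h.lt.le
  · simp [hc]

lemma branches_subset (h : Lowers M M' b y) : M'.track.branches ⊆ M.track.branches := by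
  rw [h.branches_eq]
  split_ifs
  · exact Finset.erase_subset _ _
  · exact subset_rfl

lemma trans (h : Lowers M M' b y) (h' : Lowers M' M'' b y') : Lowers M M'' b y' where
  mem := h.mem
  lt := h'.lt.trans (h.weight_self ▸ h.lt)
  weight_eq := by rw [h'.weight_eq, h.weight_eq, Function.update_idem]
  branches_eq := by
    have hy : y ≠ 0 := by
      have := h'.lt
      rw [h.weight_self] at this
      omega
    rw [h'.branches_eq, h.branches_eq, if_neg hy]

lemma bitSize_eq (h : Lowers M M' b y) :
    M'.bitSize = M.bitSize - Real.logb 2 ((M.weight b : ℝ) + 1) + Real.logb 2 ((y : ℝ) + 1) := by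
  have hrest : ∑ c ∈ M.track.branches.erase b, Real.logb 2 ((M'.weight c : ℝ) + 1) =
      ∑ c ∈ M.track.branches.erase b, Real.logb 2 ((M.weight c : ℝ) + 1) := by
    refine Finset.sum_congr rfl fun c hc => ?_
    rw [h.weight_eq, Function.update_of_ne (Finset.ne_of_mem_erase hc)]
  have hM := Finset.add_sum_erase M.track.branches
    (fun c => Real.logb 2 ((M.weight c : ℝ) + 1)) h.mem
  have hM' := Finset.add_sum_erase M.track.branches
    (fun c => Real.logb 2 ((M'.weight c : ℝ) + 1)) h.mem
  simp only [h.weight_self, hrest] at hM'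
  unfold bitSize
  rw [h.branches_eq]
  -- A removed branch would contribute `log₂ (0 + 1) = 0`, so both cases obey the same formula.
  split_ifs with hy
  · subst hy
    rw [hrest]
    simp only [Nat.cast_zero, zero_add, Real.logb_one]
    linarith
  · linarith

lemma bitSize_lt (h : Lowers M M' b y) : M'.bitSize < M.bitSize := by
  have : Real.logb 2 ((y : ℝ) + 1) < Real.logb 2 ((M.weight b : ℝ) + 1) := by
    refine Real.logb_lt_logb one_lt_two (by positivity) ?_
    exact_mod_cast Nat.succ_lt_succ h.lt
  rw [h.bitSize_eq]
  linarith

end Lowers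

variable [DecidableEq Sw]

lemma split_ends (M : MeasuredTrack Sw Br) (s : Sw) (ω η : Bool) (f : BranchEnd Br) (z : Sw)
    (d : Bool) : (split s ω η f M).track.ends z d =
      (M.track.ends z d).flatMap (M.splitEnd s ω η f) := rfl

lemma split_weight (M : MeasuredTrack Sw Br) (s : Sw) (ω η : Bool) (f : BranchEnd Br) :
    (split s ω η f M).weight = Function.update M.weight f.1
      (M.weight f.1 - M.listWeight (M.splittingEnds s ω η f)) := rfl

/-- In the order `ω` the pushed ends always land just before `f.flip`, so the two orientation cases
of `split` become one. -/
lemma split_orderedEnds_same (M : MeasuredTrack Sw Br) (s : Sw) (ω η : Bool) (f : BranchEnd Br) :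
    (split s ω η f M).track.orderedEnds s ω η =
      (M.track.orderedEnds s ω η).flatMap fun e =>
        if e ∈ M.splittingEnds s ω η f then []
        else if e = f.flip then M.splittingEnds s ω η f ++
          (if M.weight f.1 = M.listWeight (M.splittingEnds s ω η f) then [] else [f.flip])
        else if e = f ∧ M.weight f.1 = M.listWeight (M.splittingEnds s ω η f) then []
        else [e] := by
  unfold Track.orderedEnds
  rw [split_ends]
  by_cases hη : η = ω
  · simp only [hη, if_true]
    refine List.flatMap_congr fun e _ => ?_
    simp [splitEnd]
  · simp only [hη, if_false]
    rw [List.reverse_flatMap]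
    refine List.flatMap_congr fun e _ => ?_
    simp only [splitEnd, hη, if_false, Function.comp_apply]
    split_ifs <;> simp

namespace CanPush

variable {M : MeasuredTrack Sw Br} {s : Sw} {ω η : Bool} {f : BranchEnd Br}

lemma listWeight_split_of_branch_ne {l : List (BranchEnd Br)} (hl : ∀ e ∈ l, e.1 ≠ f.1) :
    (split s ω η f M).listWeight l = M.listWeight l := by
  unfold listWeight
  congr 1
  refine List.map_congr_left fun e he => ?_
  rw [split_weight, Function.update_of_ne (hl e he)]

/-- At `f.flip` the arriving weight compensates exactly for what the branch loses. -/
lemma listWeight_splitEnd (h : M.CanPush s ω η f) {e : BranchEnd Br}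
    (he : e ∉ M.splittingEnds s ω η f) (hef : e ≠ f) :
    (split s ω η f M).listWeight (M.splitEnd s ω η f e) = M.weight e.1 := by
  have hS : (split s ω η f M).listWeight (M.splittingEnds s ω η f) =
      M.listWeight (M.splittingEnds s ω η f) :=
    listWeight_split_of_branch_ne fun e he => h.branch_ne he
  have hle := M.listWeight_splittingEnds_le s ω η f
  have hf : f.flip.1 = f.1 := rfl
  unfold splitEnd
  split_ifs with h4 h5 h6 h6 h6
  · rw [listWeight_append, hS, listWeight_nil, h4, hf, h6, add_zero]
  · rw [listWeight_append, hS, listWeight_cons, listWeight_nil, h4, hf, split_weight,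
      Function.update_self]
    omega
  · rw [listWeight_append, listWeight_reverse, hS, listWeight_nil, h4, hf, h6, zero_add]
  · rw [listWeight_append, listWeight_reverse, hS, listWeight_cons, listWeight_nil, h4, hf,
      split_weight, Function.update_self]
    omega
  · exact absurd h6.1 hef
  · refine (listWeight_split_of_branch_ne fun e' he' => ?_).trans (by simp [listWeight_cons])
    obtain rfl : e' = e := by simpa using he'
    intro heq
    rcases BranchEnd.eq_or_eq_flip heq with h7 | h7
    · exact hef h7
    · exact h4 h7

lemma listWeight_flatMap (h : M.CanPush s ω η f) {l : List (BranchEnd Br)}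
    (hl : ∀ e ∈ l, e ∉ M.splittingEnds s ω η f ∧ e ≠ f) :
    (split s ω η f M).listWeight (l.flatMap (M.splitEnd s ω η f)) = M.listWeight l := by
  induction l with
  | nil => rfl
  | cons e l ih =>
    rw [List.flatMap_cons, listWeight_append, listWeight_cons,
      h.listWeight_splitEnd (hl e (by simp)).1 (hl e (by simp)).2,
      ih fun e' he' => hl e' (by simp [he'])]

lemma listWeight_splitEnd_self (h : M.CanPush s ω η f) :
    (split s ω η f M).listWeight (M.splitEnd s ω η f f) =
      M.weight f.1 - M.listWeight (M.splittingEnds s ω η f) := by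
  have hf : f ≠ f.flip := (Track.flip_ne f).symm
  unfold splitEnd
  rw [if_neg h.not_mem, if_neg hf]
  split_ifs with h6
  · rw [listWeight_nil, ← h6.2, Nat.sub_self]
  · rw [listWeight_cons, listWeight_nil, split_weight, Function.update_self, add_zero]

/-- The side `η` loses the pushed ends and the opposite side loses the same amount at `f`.
Everything else keeps its weight, even if `f.flip` also lies at `s`. -/
lemma split_switch (h : M.CanPush s ω η f) :
    (split s ω η f M).listWeight ((split s ω η f M).track.ends s η) =
      (split s ω η f M).listWeight ((split s ω η f M).track.ends s (!η)) := by
  obtain ⟨rest, hrest, -⟩ := M.exists_orderedEnds_eq s ω η f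
  have hp : (M.splittingEnds s ω η f ++ rest).Perm (M.track.ends s η) :=
    hrest ▸ orderedEnds_perm M.track s ω η
  have hnd : (M.splittingEnds s ω η f ++ rest).Nodup := hrest ▸ h.regular.nodup_orderedEnds ω η
  have hq : (f :: (M.track.orderedEnds s ω (!η)).erase f).Perm (M.track.ends s (!η)) :=
    (List.perm_cons_erase (mem_orderedEnds.2 h.mem)).symm.trans (orderedEnds_perm _ _ _ _)
  have hnd' : (f :: (M.track.orderedEnds s ω (!η)).erase f).Nodup :=
    (List.perm_cons_erase (mem_orderedEnds.2 h.mem)).nodup_iff.1 (h.regular.nodup_orderedEnds _ _)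
  have hsw := h.regular.switch η
  rw [← listWeight_perm M hp, ← listWeight_perm M hq, listWeight_append, listWeight_cons] at hsw
  rw [split_ends, split_ends, ← listWeight_perm _ (hp.flatMap_right _),
    ← listWeight_perm _ (hq.flatMap_right _), List.flatMap_append, List.flatMap_cons,
    listWeight_append, listWeight_append, flatMap_splittingEnds, listWeight_nil,
    h.listWeight_splitEnd_self, h.listWeight_flatMap, h.listWeight_flatMap]
  · have := M.listWeight_splittingEnds_le s ω η f
    omega
  · intro e he
    have he' : e ∈ M.track.ends s (!η) := hq.mem_iff.1 (List.mem_cons_of_mem _ he)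
    refine ⟨fun hS => h.regular.not_mem_opposite (mem_of_mem_splittingEnds hS) he', ?_⟩
    rintro rfl
    exact (List.nodup_cons.1 hnd').1 he
  · intro e he
    refine ⟨fun hS => (List.nodup_append'.1 hnd).2.2 hS he, ?_⟩
    rintro rfl
    exact h.regular.not_mem_opposite (hp.mem_iff.1 (List.mem_append_right _ he)) h.mem

lemma lowers_split (h : M.CanPush s ω η f) :
    Lowers M (split s ω η f M) f.1 (M.weight f.1 - M.listWeight (M.splittingEnds s ω η f)) where
  mem := h.regular.mem_branches _ _ h.mem
  lt := Nat.sub_lt (h.regular.weight_pos h.mem) h.listWeight_pos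
  weight_eq := rfl
  branches_eq := by
    have hle := M.listWeight_splittingEnds_le s ω η f
    have hiff : M.weight f.1 = M.listWeight (M.splittingEnds s ω η f) ↔
        M.weight f.1 - M.listWeight (M.splittingEnds s ω η f) = 0 := by omega
    exact if_congr hiff rfl rfl

lemma regularAt_split (h : M.CanPush s ω η f) : (split s ω η f M).RegularAt s where
  nodup := by
    rw [split_ends, split_ends, ← List.flatMap_append]
    exact h.nodup_flatMap h.regular.nodup
  mem_branches := by
    intro d z hz
    rw [split_ends] at hz
    obtain ⟨e, he, hz⟩ := List.mem_flatMap.1 hz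
    have hz' := h.mem_splitEnd hz
    have hmem : z.1 ∈ M.track.branches := by
      rcases hz'.1 with ⟨rfl, -⟩ | ⟨-, hS⟩
      · exact h.regular.mem_branches d _ he
      · exact h.regular.mem_branches η _ (mem_of_mem_splittingEnds hS)
    change z.1 ∈ if M.weight f.1 = M.listWeight (M.splittingEnds s ω η f) then
      M.track.branches.erase f.1 else M.track.branches
    split_ifs with hv
    · exact Finset.mem_erase.2 ⟨hz'.2 hv, hmem⟩
    · exact hmem
  pos := by
    intro b hb
    have hl := h.lowers_split
    have hb' := hl.branches_subset hb
    rw [hl.weight_eq]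
    rcases eq_or_ne b f.1 with rfl | hne
    · rw [Function.update_self]
      by_contra h0
      rw [hl.branches_eq, if_pos (by omega)] at hb
      simp at hb
    · rw [Function.update_of_ne hne]
      exact h.regular.pos b hb'
  switch := by
    have := h.split_switch
    intro d
    rcases Bool.eq_or_eq_not d η with rfl | rfl
    · exact this
    · rw [Bool.not_not]
      exact this.symm

lemma mem_ends_split (h : M.CanPush s ω η f)
    (hv : M.weight f.1 ≠ M.listWeight (M.splittingEnds s ω η f)) :
    f ∈ (split s ω η f M).track.ends s (!η) := by
  rw [split_ends]
  refine List.mem_flatMap.2 ⟨f, h.mem, ?_⟩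
  simp [splitEnd, h.not_mem, hv, (Track.flip_ne f).symm]

lemma head?_orderedEnds_split (h : M.CanPush s ω η f)
    (hf : (M.track.orderedEnds s ω (!η)).head? = some f)
    (hv : M.weight f.1 ≠ M.listWeight (M.splittingEnds s ω η f)) :
    ((split s ω η f M).track.orderedEnds s ω (!η)).head? = some f := by
  have hφ : M.splitEnd s ω η f f = [f] := by
    simp [splitEnd, h.not_mem, hv, (Track.flip_ne f).symm]
  obtain ⟨l, hl⟩ := List.head?_eq_some_iff.1 hf
  unfold Track.orderedEnds at hl ⊢
  rw [split_ends]
  split_ifs at hl ⊢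
  · rw [hl, List.flatMap_cons, hφ]
    simp
  · rw [List.reverse_flatMap, hl, List.flatMap_cons, Function.comp_apply, hφ]
    simp

lemma orderedEnds_split_of_ne (h : M.CanPush s ω η f) {e : BranchEnd Br}
    {rest : List (BranchEnd Br)}
    (hrest : M.track.orderedEnds s ω η = M.splittingEnds s ω η f ++ e :: rest)
    (hv : M.weight f.1 ≠ M.listWeight (M.splittingEnds s ω η f)) (he : e ≠ f.flip) :
    ((split s ω η f M).track.orderedEnds s ω η).head? = some e := by
  have hnd : (M.splittingEnds s ω η f ++ e :: rest).Nodup :=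
    hrest ▸ h.regular.nodup_orderedEnds ω η
  have heS : e ∉ M.splittingEnds s ω η f := fun hS =>
    (List.nodup_append'.1 hnd).2.2 hS (by simp)
  rw [split_orderedEnds_same]
  nth_rewrite 1 [hrest]
  rw [List.flatMap_append, List.flatMap_eq_nil_iff.2 fun e he => if_pos he, List.flatMap_cons]
  simp [heS, he, hv]

lemma orderedEnds_split_of_eq_flip (h : M.CanPush s ω η f) {rest : List (BranchEnd Br)}
    (hrest : M.track.orderedEnds s ω η = M.splittingEnds s ω η f ++ f.flip :: rest)
    (hv : M.weight f.1 ≠ M.listWeight (M.splittingEnds s ω η f)) :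
    ∃ rest', (split s ω η f M).track.orderedEnds s ω η =
      M.splittingEnds s ω η f ++ f.flip :: rest' := by
  rw [split_orderedEnds_same]
  nth_rewrite 1 [hrest]
  rw [List.flatMap_append, List.flatMap_eq_nil_iff.2 fun e he => if_pos he, List.flatMap_cons]
  simp [h.flip_not_mem, hv]

end CanPush

end split

end MeasuredTrack

/-! ### One step of the procedure -/

namespace MeasuredTrack

open Finset

variable {Sw Br : Type*} {M M' : MeasuredTrack Sw Br} {s : Sw} {ω η : Bool} {f : BranchEnd Br}

/-- `f.flip` cannot be pushed: it is not the first end, and at a later place its weight together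
with that of the first end would exceed the weight of `f.1`. -/
lemma MoveSetup.canPush (h : M.MoveSetup s ω η f) (hM : M.RegularAt s) : M.CanPush s ω η f := by
  obtain ⟨e, he, hle⟩ := h.le
  obtain ⟨l, hl⟩ := splittingEnds_eq_cons he hle
  refine ⟨hM, mem_orderedEnds.1 (List.mem_of_head? h.first), by simp [hl], fun hmem => ?_⟩
  have hpos := hM.weight_pos (mem_orderedEnds.1 (List.mem_of_head? he))
  have hw := M.listWeight_splittingEnds_le s ω η f
  rw [hl, listWeight_cons] at hw
  rw [hl] at hmem
  rcases List.mem_cons.1 hmem with rfl | hmem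
  · exact h.not_closed he
  · have h1 : M.weight f.1 ≤ M.listWeight l := M.weight_le_listWeight (e := f.flip) hmem
    omega

/-- The branch `c` comes first at `s` in one direction, and the first branch in the other direction
is heavier, so that the end of `c` is pushed by the next move. -/
def Trails (M : MeasuredTrack Sw Br) (s : Sw) (ω : Bool) (c : Br) : Prop :=
  ∃ (η : Bool) (f e : BranchEnd Br), (M.track.orderedEnds s ω η).head? = some e ∧
    (M.track.orderedEnds s ω (!η)).head? = some f ∧ f.1 = c ∧ M.weight c < M.weight e.1

/-- The strict inequality in `Trails` forces the choice of `η`, so the end of `c` is the first one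
pushed. -/
lemma MoveSetup.weight_le_of_trails (h : M.MoveSetup s ω η f) {c : Br} (hc : M.Trails s ω c) :
    M.weight c ≤ M.listWeight (M.splittingEnds s ω η f) := by
  obtain ⟨η', f', e', he', hf', rfl, hlt⟩ := hc
  obtain ⟨e, he, hle⟩ := h.le
  rcases Bool.eq_or_eq_not η η' with rfl | rfl
  · have h1 := h.first.symm.trans hf'
    have h2 := he.symm.trans he'
    simp only [Option.some.injEq] at h1 h2
    subst h1 h2
    omega
  · have h1 := he.symm.trans hf'
    simp only [Option.some.injEq] at h1
    subst h1
    obtain ⟨l, hl⟩ := splittingEnds_eq_cons he hle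
    rw [hl, listWeight_cons]
    omega

lemma bitSize_nonneg (M : MeasuredTrack Sw Br) : 0 ≤ M.bitSize := by
  refine Finset.sum_nonneg fun b _ => Real.logb_nonneg one_lt_two ?_
  have : (0 : ℝ) ≤ M.weight b := Nat.cast_nonneg _
  linarith

variable [DecidableEq Br]

lemma bitSize_le_sub_one_of_lowers {b : Br} {y : ℕ} (h : Lowers M M' b y)
    (hy : 2 * (y + 1) ≤ M.weight b + 1) : M'.bitSize ≤ M.bitSize - 1 := by
  have h1 : Real.logb 2 (2 * ((y : ℝ) + 1)) ≤ Real.logb 2 ((M.weight b : ℝ) + 1) := by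
    refine Real.logb_le_logb_of_le one_lt_two (by positivity) ?_
    exact_mod_cast hy
  rw [Real.logb_mul (by norm_num) (by positivity), Real.logb_self_eq_one one_lt_two] at h1
  rw [h.bitSize_eq]
  linarith

variable [DecidableEq Sw]

/-- The end following `S` belongs to the branch `f.1` itself, so adding it always overflows. Hence
the same block `S` is pushed as long as its weight `w` fits, and it returns to its place before
`f.flip` each time. -/
lemma lowers_iterate_split {S : List (BranchEnd Br)} {w : ℕ} (hS : S ≠ []) (hfS : f.flip ∉ S)
    (k : ℕ) :
    ∀ (M : MeasuredTrack Sw Br) (rest : List (BranchEnd Br)), M.RegularAt s →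
      f ∈ M.track.ends s (!η) → M.track.orderedEnds s ω η = S ++ f.flip :: rest →
      M.listWeight S = w → (k + 1) * w ≤ M.weight f.1 →
      ((split s ω η f)^[k + 1] M).RegularAt s ∧
        Lowers M ((split s ω η f)^[k + 1] M) f.1 (M.weight f.1 - (k + 1) * w) := by
  induction k with
  | zero =>
    intro M rest hM hf hrest hw hle
    have hpos := hM.weight_pos ((mem_orderedEnds (ω := ω)).1
      (hrest ▸ List.mem_append_left _ (List.head_mem hS)))
    have hwpos := M.weight_le_listWeight (List.head_mem hS)
    have hSe : M.splittingEnds s ω η f = S := by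
      refine splittingEnds_eq_of_orderedEnds_eq hrest (by omega) ?_
      change M.weight f.1 < M.listWeight S + M.weight f.1
      omega
    have hp : M.CanPush s ω η f := ⟨hM, hf, hSe ▸ hS, hSe ▸ hfS⟩
    have hl := hp.lowers_split
    rw [hSe, hw] at hl
    simpa using And.intro hp.regularAt_split hl
  | succ k ih =>
    intro M rest hM hf hrest hw hle
    have hpos := hM.weight_pos ((mem_orderedEnds (ω := ω)).1
      (hrest ▸ List.mem_append_left _ (List.head_mem hS)))
    have hwpos := M.weight_le_listWeight (List.head_mem hS)
    have hle' : (k + 1) * w + w ≤ M.weight f.1 := by linarith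
    have hkw : w ≤ (k + 1) * w := Nat.le_mul_of_pos_left w k.succ_pos
    have hSe : M.splittingEnds s ω η f = S := by
      refine splittingEnds_eq_of_orderedEnds_eq hrest (by omega) ?_
      change M.weight f.1 < M.listWeight S + M.weight f.1
      omega
    have hp : M.CanPush s ω η f := ⟨hM, hf, hSe ▸ hS, hSe ▸ hfS⟩
    have hv : M.weight f.1 ≠ M.listWeight (M.splittingEnds s ω η f) := by
      rw [hSe]
      omega
    have hl := hp.lowers_split
    obtain ⟨rest', hrest'⟩ := hp.orderedEnds_split_of_eq_flip (hSe.symm ▸ hrest) hv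
    rw [hSe] at hrest'
    have hwS : (split s ω η f M).listWeight S = w := by
      rw [← hw]
      exact CanPush.listWeight_split_of_branch_ne fun e he => hp.branch_ne (hSe.symm ▸ he)
    rw [hSe, hw] at hl
    have hself := hl.weight_self
    obtain ⟨hr, hl'⟩ := ih (split s ω η f M) rest' hp.regularAt_split (hp.mem_ends_split hv) hrest'
      hwS (by rw [hself]; omega)
    rw [Function.iterate_succ_apply]
    refine ⟨hr, ?_⟩
    have := hl.trans hl'
    rwa [hself, Nat.sub_sub, show w + (k + 1) * w = (k + 1 + 1) * w by ring] at this

lemma MoveSetup.lowers_twist (h : M.MoveSetup s ω η f) (hM : M.RegularAt s)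
    (ht : M.CanTwist s ω η f) :
    (twist s ω η f M).RegularAt s ∧ Lowers M (twist s ω η f M) f.1
      (M.weight f.1 % M.listWeight (M.splittingEnds s ω η f)) := by
  have hp := h.canPush hM
  obtain ⟨rest, hrest, hhead⟩ := M.exists_orderedEnds_eq s ω η f
  obtain ⟨rest', rfl⟩ := List.head?_eq_some_iff.1 (hhead.trans ht)
  have hdiv : 0 < M.weight f.1 / M.listWeight (M.splittingEnds s ω η f) :=
    Nat.div_pos (M.listWeight_splittingEnds_le s ω η f) hp.listWeight_pos
  obtain ⟨k, hk⟩ := Nat.exists_eq_succ_of_ne_zero hdiv.ne'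
  have hmod := Nat.mod_add_div' (M.weight f.1) (M.listWeight (M.splittingEnds s ω η f))
  have key := lowers_iterate_split (s := s) (ω := ω) (η := η) hp.ne_nil hp.flip_not_mem k M rest' hM
    hp.mem hrest rfl (by rw [← Nat.succ_eq_add_one, ← hk]; omega)
  rw [← Nat.succ_eq_add_one, ← hk] at key
  rwa [show M.weight f.1 - M.weight f.1 / M.listWeight (M.splittingEnds s ω η f) *
    M.listWeight (M.splittingEnds s ω η f) =
      M.weight f.1 % M.listWeight (M.splittingEnds s ω η f) by omega] at key

/-- If the whole side is pushed, the switch condition forces `f.1` to vanish. Otherwise the next end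
`e` becomes first, and maximality of the block makes it heavier than what remains of `f.1`. -/
lemma MoveSetup.vanish_or_trails (h : M.MoveSetup s ω η f) (hM : M.RegularAt s)
    (ht : ¬ M.CanTwist s ω η f) :
    M.weight f.1 = M.listWeight (M.splittingEnds s ω η f) ∨ (split s ω η f M).Trails s ω f.1 := by
  have hp := h.canPush hM
  have hle := M.listWeight_splittingEnds_le s ω η f
  obtain ⟨rest, hrest, hhead⟩ := M.exists_orderedEnds_eq s ω η f
  refine or_iff_not_imp_left.2 fun hv => ?_
  cases rest with
  | nil =>
    have h1 := hM.switch_orderedEnds ω η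
    have h2 := M.weight_le_listWeight (List.mem_of_head? h.first)
    rw [hrest, List.append_nil] at h1
    omega
  | cons e rest =>
    have hne : e ≠ f.flip := by
      rintro rfl
      exact ht (hhead.symm.trans rfl)
    have hlt := lt_listWeight_of_orderedEnds_eq hrest
    have he : e ∈ M.track.ends s η := (mem_orderedEnds (ω := ω)).1 (by rw [hrest]; simp)
    have heb : e.1 ≠ f.1 := by
      intro heq
      rcases BranchEnd.eq_or_eq_flip heq with rfl | h1
      · exact hM.not_mem_opposite he hp.mem
      · exact hne h1
    refine ⟨η, f, e, hp.orderedEnds_split_of_ne hrest hv hne,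
      hp.head?_orderedEnds_split h.first hv, rfl, ?_⟩
    rw [split_weight, Function.update_self, Function.update_of_ne heb]
    omega

/-- One step lowers the weight of one branch. Unless that weight is halved, the branch is pushed
along the next one. -/
theorem AHTStep.exists_lowers (hM : M.RegularAt s) (h : AHTStep s ω M M') :
    M'.RegularAt s ∧ ∃ b y, Lowers M M' b y ∧
      (2 * (y + 1) ≤ M.weight b + 1 ∨ M'.Trails s ω b) ∧
      ∀ c, M.Trails s ω c → y + M.weight c ≤ M.weight b := by
  cases h with
  | twist η f hs ht =>
    obtain ⟨hr, hl⟩ := hs.lowers_twist hM ht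
    have hp := hs.canPush hM
    have hle := M.listWeight_splittingEnds_le s ω η f
    have hmod := Nat.mod_lt (M.weight f.1) hp.listWeight_pos
    have hmod' : M.weight f.1 % M.listWeight (M.splittingEnds s ω η f) +
        M.listWeight (M.splittingEnds s ω η f) ≤ M.weight f.1 := by
      have h1 := Nat.mod_add_div' (M.weight f.1) (M.listWeight (M.splittingEnds s ω η f))
      have h2 := Nat.le_mul_of_pos_left (M.listWeight (M.splittingEnds s ω η f))
        (Nat.div_pos hle hp.listWeight_pos)
      omega
    -- A remainder `y < w` with `y + w ≤ x` satisfies `2y < x`, so a twist always halves.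
    refine ⟨hr, f.1, _, hl, Or.inl (by omega), fun c hc => ?_⟩
    have := hs.weight_le_of_trails hc
    omega
  | split η f hs ht =>
    have hp := hs.canPush hM
    have hle := M.listWeight_splittingEnds_le s ω η f
    have hpos := hM.weight_pos hp.mem
    refine ⟨hp.regularAt_split, f.1, _, hp.lowers_split, ?_, fun c hc => ?_⟩
    · rcases hs.vanish_or_trails hM ht with hv | htr
      · left
        omega
      · exact Or.inr htr
    · have := hs.weight_le_of_trails hc
      omega

/-! ### Pigeonhole over a sequence of steps -/

section sequence

variable {n : ℕ} {T : ℕ → MeasuredTrack Sw Br}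

lemma regularAt_of_steps (h0 : (T 0).RegularAt s) (hstep : ∀ i < n, AHTStep s ω (T i) (T (i + 1)))
    {i : ℕ} (hi : i ≤ n) : (T i).RegularAt s := by
  induction i with
  | zero => exact h0
  | succ i ih => exact (AHTStep.exists_lowers (ih (by omega)) (hstep i hi)).1

/-- In any sequence of more steps than there are branches, the bit-size drops by `1` before the
number of steps exceeds the number of branches by more than `1`. -/
theorem exists_bitSize_le_sub_one (h0 : (T 0).RegularAt s)
    (hstep : ∀ i < n, AHTStep s ω (T i) (T (i + 1))) (hn : (T 0).track.branches.card + 1 ≤ n) :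
    ∃ k, 1 ≤ k ∧ k ≤ (T 0).track.branches.card + 1 ∧ (T k).bitSize ≤ (T 0).bitSize - 1 := by
  set E := (T 0).track.branches.card with hE
  by_contra! hcon
  have hreg : ∀ i ≤ n, (T i).RegularAt s := fun i hi => regularAt_of_steps h0 hstep hi
  have hex : ∀ i, ∃ b y, i < n → (Lowers (T i) (T (i + 1)) b y ∧
      (2 * (y + 1) ≤ (T i).weight b + 1 ∨ (T (i + 1)).Trails s ω b) ∧
      ∀ c, (T i).Trails s ω c → y + (T i).weight c ≤ (T i).weight b) := by
    intro i
    by_cases hi : i < n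
    · obtain ⟨b, y, h⟩ := (AHTStep.exists_lowers (hreg i hi.le) (hstep i hi)).2
      exact ⟨b, y, fun _ => h⟩
    -- Beyond the end of the sequence the values are irrelevant; step `0` supplies some.
    · obtain ⟨b, y, -⟩ := (AHTStep.exists_lowers h0 (hstep 0 (by omega))).2
      exact ⟨b, y, fun h => absurd h hi⟩
  choose b y hby using hex
  have hlow : ∀ i < n, Lowers (T i) (T (i + 1)) (b i) (y i) := fun i hi => (hby i hi).1
  have hmono : ∀ i j, i ≤ j → j ≤ n → (T j).bitSize ≤ (T i).bitSize := by
    intro i j hij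
    induction j, hij using Nat.le_induction with
    | base => exact fun _ => le_rfl
    | succ j hij ih => exact fun hj => (hlow j hj).bitSize_lt.le.trans (ih (by omega))
  have hwmono : ∀ c i j, i ≤ j → j ≤ n → (T j).weight c ≤ (T i).weight c := by
    intro c i j hij
    induction j, hij using Nat.le_induction with
    | base => exact fun _ => le_rfl
    | succ j hij ih => exact fun hj => ((hlow j hj).weight_le c).trans (ih (by omega))
  have hbr : ∀ i ≤ n, (T i).track.branches ⊆ (T 0).track.branches := by
    intro i
    induction i with
    | zero => exact fun _ => subset_rfl
    | succ i ih => exact fun hi => (hlow i hi).branches_subset.trans (ih (by omega))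
  have hnodrop : ∀ i ≤ E, (T i).weight (b i) + 1 < 2 * (y i + 1) := by
    intro i hi
    by_contra! hle
    have h1 := bitSize_le_sub_one_of_lowers (hlow i (by omega)) hle
    have h2 := hmono 0 i (Nat.zero_le _) (by omega)
    have h3 := hcon (i + 1) (by omega) (by omega)
    linarith
  have hypos : ∀ i ≤ E, 1 ≤ y i := by
    intro i hi
    have h1 := hnodrop i hi
    have h2 := (hlow i (by omega)).lt
    omega
  have hadd : ∀ i, i + 1 ≤ E → y (i + 1) + y i ≤ (T (i + 1)).weight (b (i + 1)) := by
    intro i hi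
    have h1 := hnodrop i (by omega)
    have h2 := (hby i (by omega)).2.1.resolve_left (by omega)
    have h3 := (hby (i + 1) (by omega)).2.2 (b i) h2
    rwa [(hlow i (by omega)).weight_self] at h3
  -- Each of the `E + 1` steps `0, …, E` lowers one of the `E` initial branches.
  obtain ⟨i, hi, j, hj, hij, hb⟩ : ∃ i ∈ range (E + 1), ∃ j ∈ range (E + 1), i ≠ j ∧ b i = b j := by
    refine Finset.exists_ne_map_eq_of_card_lt_of_maps_to (t := (T 0).track.branches)
      (by simp [hE]) fun i hi => ?_
    have hi' : i < E + 1 := Finset.mem_range.1 hi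
    exact hbr i (by omega) (hlow i (by omega)).mem
  rw [Finset.mem_range] at hi hj
  wlog hlt : i < j generalizing i j
  · exact this j hj i hi hij.symm hb.symm (by omega)
  obtain ⟨m, rfl⟩ : ∃ m, j = m + 1 := ⟨j - 1, by omega⟩
  -- Each step loses `log₂ (x + 1) - log₂ (y + 1)`, and `x` is at least the `y` of the step before.
  have htel : ∀ m, i ≤ m → m ≤ E → (T (m + 1)).bitSize - Real.logb 2 ((y m : ℝ) + 1) ≤
      (T (i + 1)).bitSize - Real.logb 2 ((y i : ℝ) + 1) := by
    intro m him
    induction m, him using Nat.le_induction with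
    | base => exact fun _ => le_rfl
    | succ m him ih =>
      intro hm
      have h1 := ih (by omega)
      have h2 := (hlow (m + 1) (by omega)).bitSize_eq
      have h3 : Real.logb 2 ((y m : ℝ) + 1) ≤
          Real.logb 2 (((T (m + 1)).weight (b (m + 1)) : ℝ) + 1) := by
        refine Real.logb_le_logb_of_le one_lt_two (by positivity) ?_
        have := hadd m hm
        exact_mod_cast (by omega : y m + 1 ≤ (T (m + 1)).weight (b (m + 1)) + 1)
      linarith
  have h1 := htel m (by omega) (by omega)
  have h2 := (hlow (m + 1) (by omega)).bitSize_eq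
  have h3 := hadd m (by omega)
  -- Step `i` left this branch with weight `y i`, and weights never increase.
  have h4 : (T (m + 1)).weight (b (m + 1)) ≤ y i := by
    have := hwmono (b i) (i + 1) (m + 1) (by omega) (by omega)
    rwa [(hlow i (by omega)).weight_self, hb] at this
  have h5 := hypos m (by omega)
  have h6 := hypos (m + 1) (by omega)
  generalize (T (m + 1)).weight (b (m + 1)) = t at *
  -- The square exceeds the left side by `y m ^ 2 + y (m + 1) ^ 2 - 1`, which is nonnegative since
  -- both values are positive.
  have h7 : 2 * ((y m + 1) * (y (m + 1) + 1)) ≤ (y i + 1) * (t + 1) := by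
    calc 2 * ((y m + 1) * (y (m + 1) + 1))
        ≤ (y (m + 1) + y m + 1) * (y (m + 1) + y m + 1) := by nlinarith
      _ ≤ (y i + 1) * (t + 1) := Nat.mul_le_mul (by omega) (by omega)
  have h8 : Real.logb 2 (2 * (((y m : ℝ) + 1) * ((y (m + 1) : ℝ) + 1))) ≤
      Real.logb 2 (((y i : ℝ) + 1) * ((t : ℝ) + 1)) := by
    refine Real.logb_le_logb_of_le one_lt_two (by positivity) ?_
    exact_mod_cast h7
  rw [Real.logb_mul (by norm_num) (by positivity), Real.logb_self_eq_one one_lt_two,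
    Real.logb_mul (by positivity) (by positivity),
    Real.logb_mul (by positivity) (by positivity)] at h8
  have h9 := hmono 0 (i + 1) (by omega) (by omega)
  have h10 := hcon (m + 1 + 1) (by omega) (by omega)
  linarith

/-- A sequence of `n` steps lowers the bit-size by more than `n / N - 1`, where `N` exceeds the
number of branches. -/
theorem lt_mul_bitSize_sub {N : ℕ} (n : ℕ) : ∀ (T : ℕ → MeasuredTrack Sw Br), (T 0).RegularAt s →
    (∀ i < n, AHTStep s ω (T i) (T (i + 1))) → (T 0).track.branches.card + 1 ≤ N →
    (n : ℝ) < N * ((T 0).bitSize - (T n).bitSize + 1) := by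
  induction n using Nat.strong_induction_on with
  | _ n ih =>
    intro T h0 hstep hN
    have hNpos : (0 : ℝ) < N := by exact_mod_cast (by omega : 0 < N)
    have hreg : ∀ i ≤ n, (T i).RegularAt s := fun i hi => regularAt_of_steps h0 hstep hi
    -- A short sequence needs only that one step strictly lowers the bit-size, which makes the
    -- factor of `N` exceed `1`. In a long one, the first `k ≤ N` steps are paid for by a drop of
    -- `1`.
    by_cases hn : n ≤ N
    · rcases Nat.eq_zero_or_pos n with rfl | hpos
      · simpa using hNpos
      · have hlt : ∀ m, m + 1 ≤ n → (T (m + 1)).bitSize < (T 0).bitSize := by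
          intro m
          induction m with
          | zero =>
            intro hm
            obtain ⟨b, y, hl, -⟩ := (AHTStep.exists_lowers (hreg 0 (by omega)) (hstep 0 hm)).2
            exact hl.bitSize_lt
          | succ m ihm =>
            intro hm
            obtain ⟨b, y, hl, -⟩ :=
              (AHTStep.exists_lowers (hreg (m + 1) (by omega)) (hstep (m + 1) hm)).2
            exact hl.bitSize_lt.trans (ihm (by omega))
        obtain ⟨m, rfl⟩ : ∃ m, n = m + 1 := ⟨n - 1, by omega⟩
        have h1 := hlt m le_rfl
        have h2 : ((m + 1 : ℕ) : ℝ) ≤ N := by exact_mod_cast hn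
        have h3 : (N : ℝ) * 1 < N * ((T 0).bitSize - (T (m + 1)).bitSize + 1) :=
          mul_lt_mul_of_pos_left (by linarith) hNpos
        linarith
    · obtain ⟨k, hk1, hkE, hk⟩ := exists_bitSize_le_sub_one h0 hstep (by omega)
      have hbr : ∀ i ≤ n, (T i).track.branches ⊆ (T 0).track.branches := by
        intro i
        induction i with
        | zero => exact fun _ => subset_rfl
        | succ i ihi =>
          intro hi
          obtain ⟨b, y, hl, -⟩ := (AHTStep.exists_lowers (hreg i (by omega)) (hstep i hi)).2
          exact hl.branches_subset.trans (ihi (by omega))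
      have h1 := ih (n - k) (by omega) (fun i => T (k + i)) (hreg k (by omega))
        (fun i hi => hstep (k + i) (by omega))
        ((Nat.add_le_add_right (Finset.card_le_card (hbr k (by omega))) 1).trans hN)
      have h2 : k + (n - k) = n := by omega
      simp only [h2, add_zero] at h1
      have h3 : (k : ℝ) ≤ N := by exact_mod_cast (by omega : k ≤ N)
      have h4 : ((n - k : ℕ) : ℝ) = n - k := by
        rw [Nat.cast_sub (by omega)]
      have h5 : (N : ℝ) * ((T k).bitSize - (T n).bitSize + 1) ≤
          N * ((T 0).bitSize - 1 - (T n).bitSize + 1) :=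
        mul_le_mul_of_nonneg_left (by linarith) hNpos.le
      linarith

end sequence

end MeasuredTrack

/-! ### The main theorem -/

theorem mainTheorem9 {Sw Br : Type*} [DecidableEq Sw] [DecidableEq Br]
    (g p : ℕ) (s : Sw) (ω : Bool) (n : ℕ) (T : ℕ → MeasuredTrack Sw Br)
    (hT : MeasuredTrack.IsAHTSequence g p s ω n T) :
    ((n : ℤ) ≤ 6 * surfaceComplexity g p + 1 ∨
      ∃ k : ℕ, 1 ≤ k ∧ k ≤ n ∧ (k : ℤ) ≤ 6 * surfaceComplexity g p + 1 ∧
        (T k).bitSize ≤ (T 0).bitSize - 1) ∧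
    (∀ i ≤ n, (i : ℝ) <
      (6 * (surfaceComplexity g p : ℝ) + 1) * ((T 0).bitSize - (T i).bitSize + 1)) ∧
    (n : ℝ) < (6 * (surfaceComplexity g p : ℝ) + 1) * ((T 0).bitSize + 1) := by
  have hreg := hT.fullyMeasured.regularAt hT.trainTrack.1 hT.mem
  have hcard := hT.trainTrack.card_branches_le
  -- `6ξ + 1` is a natural number because `6ξ` bounds the number of branches.
  obtain ⟨N, hN⟩ : ∃ N : ℕ, (N : ℤ) = 6 * surfaceComplexity g p + 1 :=
    ⟨(6 * surfaceComplexity g p + 1).toNat, Int.toNat_of_nonneg (by omega)⟩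
  have hNR : (6 * (surfaceComplexity g p : ℝ) + 1) = N := by exact_mod_cast hN.symm
  have hcN : (T 0).track.branches.card + 1 ≤ N := by omega
  have hbound : ∀ i ≤ n, (i : ℝ) <
      (6 * (surfaceComplexity g p : ℝ) + 1) * ((T 0).bitSize - (T i).bitSize + 1) := by
    intro i hi
    rw [hNR]
    exact MeasuredTrack.lt_mul_bitSize_sub i T hreg (fun j hj => hT.step j (by omega)) hcN
  refine ⟨?_, hbound, ?_⟩
  · refine or_iff_not_imp_left.2 fun hn => ?_
    obtain ⟨k, hk1, hkE, hk⟩ := MeasuredTrack.exists_bitSize_le_sub_one hreg hT.step (by omega)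
    exact ⟨k, hk1, by omega, by omega, hk⟩
  · refine (hbound n le_rfl).trans_le ?_
    have := (T n).bitSize_nonneg
    rw [hNR]
    exact mul_le_mul_of_nonneg_left (by linarith) (Nat.cast_nonneg N)
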